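/- Let $A$ be a finite alphabet. A pure morphic word over $A$ is an infinite word $f^{\omega}(a)=\lim_{n\to\infty} f^{n}(a)$, where $f\colon A^{*}\to A^{*}$ is a monoid morphism and $a\in A$ is a letter with $f(a)=au$ for some nonempty word $u\in A^{*}$ such that $f^{n}(u)$ is nonempty for all $n\ge 0$. A morphic word is an infinite word of the form $c(\mathbf{x})$, where $\mathbf{x}$ is a pure morphic word over some finite alphabet and $c$ is a coding, that is, a letter-to-letter morphism. The shift orbit closure $\mathcal{S}_{\mathbf{x}}$ of $\mathbf{x}\in A^{\mathbb{N}}$ is the set of all $\mathbf{y}\in A^{\mathbb{N}}$ such that every finite factor of $\mathbf{y}$ is a factor of $\mathbf{x}$. An extremal word of $\mathbf{x}$ is a word that, for some total order $\sigma$ on $A$ and some letter $b\in A$ occurring in $\mathbf{x}$, is the smallest word beginning with $b$ in $\mathcal{S}_{\mathbf{x}}$ with respect to the lexicographic order induced by $\sigma$. Theorem. If $\mathbf{x}\in\{0,1\}^{\mathbb{N}}$ is a binary pure morphic word (a pure morphic word over the alphabet $\{0,1\}$), then every extremal word of $\mathbf{x}$ is morphic. -/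

import Mathlib

namespace MorphicWords

/-- The finite word `w` occurs in the infinite word `x` at position `n`. -/
def OccursAt {A : Type*} (w : FreeMonoid A) (x : ℕ → A) (n : ℕ) : Prop :=
  ∀ (i : ℕ) (hi : i < w.toList.length), w.toList[i] = x (n + i)

/-- The finite word `w` is a prefix of the infinite word `x`. -/
def IsPrefix {A : Type*} (w : FreeMonoid A) (x : ℕ → A) : Prop :=
  OccursAt w x 0

/-- `F(x)`, the set of factors of the infinite word `x`. -/
def factors {A : Type*} (x : ℕ → A) : Set (FreeMonoid A) :=
  {w | ∃ n, OccursAt w x n}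

/-- `S_x`, the shift orbit closure of `x`: all infinite words whose factors are factors of `x`. -/
def shiftOrbitClosure {A : Type*} (x : ℕ → A) : Set (ℕ → A) :=
  {y | factors y ⊆ factors x}

/-- `x` is the infinite word `f^ω(a)`: the morphism `f` satisfies `f(a) = a u` with `u` nonempty
and `f^n(u)` nonempty for all `n`, and every `f^n(a)` is a prefix of `x`. (The lengths of the words
`f^n(a)` then tend to infinity, so that `x` is determined by `f` and `a`.) -/
def IsOmegaLimit {A : Type*} (f : FreeMonoid A →* FreeMonoid A) (a : A) (x : ℕ → A) : Prop :=
  (∃ u : FreeMonoid A, f (FreeMonoid.of a) = FreeMonoid.of a * u ∧ u ≠ 1 ∧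
    ∀ n : ℕ, f^[n] u ≠ 1) ∧
  ∀ n : ℕ, IsPrefix (f^[n] (FreeMonoid.of a)) x

/-- `x` is a pure morphic word over the alphabet `A`. -/
def IsPureMorphic {A : Type*} (x : ℕ → A) : Prop :=
  ∃ (f : FreeMonoid A →* FreeMonoid A) (a : A), IsOmegaLimit f a x

/-- `y` is a morphic word: the image of a pure morphic word over some finite alphabet `C` under
a coding (letter-to-letter morphism) `c`. -/
def IsMorphic {B : Type*} (y : ℕ → B) : Prop :=
  ∃ (C : Type) (_ : Finite C) (x : ℕ → C) (c : C → B), IsPureMorphic x ∧ y = c ∘ x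

/-- The strict lexicographic order on infinite words induced by a total order `σ` on letters. -/
def LexLT {A : Type*} (σ : LinearOrder A) (y z : ℕ → A) : Prop :=
  ∃ n, (∀ i < n, y i = z i) ∧ σ.lt (y n) (z n)

/-- `y = l_{b, σ, x}`: `y` is the lexicographically smallest word, with respect to `σ`, among the
words of the shift orbit closure of `x` that begin with the letter `b`. -/
def IsLeastBeginningWith {A : Type*} (b : A) (σ : LinearOrder A) (x y : ℕ → A) : Prop :=
  (y ∈ shiftOrbitClosure x ∧ y 0 = b) ∧
  ∀ z ∈ shiftOrbitClosure x, z 0 = b → y = z ∨ LexLT σ y z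

/-- `y` is an extremal word of `x`. -/
def IsExtremal {A : Type*} (x y : ℕ → A) : Prop :=
  ∃ (σ : LinearOrder A) (b : A), (∃ n, x n = b) ∧ IsLeastBeginningWith b σ x y

end MorphicWords

/-! If `φ 0` and `φ 1` commute, `x` is periodic, its period passes to the whole shift orbit closure,
and periodic words are morphic (`IsLimit.drop_eq`, `isMorphic_of_periodic`).

Otherwise `φ` is nonerasing, and the two noncommuting blocks always separate at the same place
(`exists_separating`), so `φ` preserves or reverses the lexicographic order. By compactness, every
word of the closure is `φ(w)` cut inside its first block, with `w` in the closure
(`exists_drop_image_eq`). If the word is extremal, monotonicity makes `w` extremal as well. Passing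
to tails turns the cut into a prefix: `y.tail = r φ(w.tail)` (`IsBinLeast.exists_desubstitution`).

An extremal word is determined by the smaller letter of the order and its own first letter, so there
are at most four, and iterated desubstitution enters a cycle. Composing around it gives `v = q g(v)`
with `g` nonerasing and expanding a letter. Such a `v` is morphic (`isMorphic_of_eq_append_image`):
it is `q g(q) g²(q) ⋯` if `q` is nonempty, and otherwise it is constant or has a suffix of that
kind. Returning to `y` only applies nonerasing morphisms and prepends finite words, which preserves
morphicity (`IsMorphic.append_image`). -/

namespace MorphicWords

open Stream' (append_append_stream append_take append_take_drop drop_append_stream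
  getElem?_take take_take length_take map_append_stream)

/-! ### Prefixes of infinite words -/

/-- The finite word `l` is a prefix of the infinite word `z`. -/
def StartsWith {A : Type*} (l : List A) (z : Stream' A) : Prop :=
  ∃ z', z = l ++ₛ z'

section Prefix

variable {A : Type*}

theorem startsWith_append (l : List A) (z : Stream' A) : StartsWith l (l ++ₛ z) := ⟨z, rfl⟩

theorem StartsWith.append {l z} (h : StartsWith (A := A) l z) (p : List A) :
    StartsWith (p ++ l) (p ++ₛ z) := by
  obtain ⟨z', rfl⟩ := h
  exact ⟨z', by rw [append_append_stream]⟩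

theorem StartsWith.of_append {l l' z} (h : StartsWith (A := A) (l ++ l') z) :
    StartsWith l z := by
  obtain ⟨z', rfl⟩ := h
  exact ⟨l' ++ₛ z', by rw [append_append_stream]⟩

theorem startsWith_take (n : ℕ) (z : Stream' A) : StartsWith (z.take n) z :=
  ⟨z.drop n, (append_take_drop n z).symm⟩

theorem startsWith_iff_take {l z} : StartsWith (A := A) l z ↔ z.take l.length = l := by
  constructor
  · rintro ⟨z', rfl⟩
    simpa using (append_take (x := l) (n := 0) (a := z')).symm
  · intro h
    have := startsWith_take l.length z
    rwa [h] at this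

theorem startsWith_iff_get {l z} :
    StartsWith (A := A) l z ↔ ∀ (i : ℕ) (hi : i < l.length), l[i] = z.get i := by
  rw [startsWith_iff_take]
  constructor
  · intro h i hi
    have h1 := getElem?_take (s := z) hi
    rw [h, List.getElem?_eq_getElem hi] at h1
    exact Option.some.inj h1
  · intro h
    apply List.ext_getElem (by simp)
    intro i h1 h2
    have h3 := getElem?_take (s := z) h2
    rw [List.getElem?_eq_getElem h1] at h3
    rw [h i h2]
    exact Option.some.inj h3

theorem StartsWith.getElem {l z} (h : StartsWith (A := A) l z) {i : ℕ} (hi : i < l.length) :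
    l[i] = z.get i :=
  startsWith_iff_get.1 h i hi

theorem eq_of_common_prefixes {z z' : Stream' A}
    (h : ∀ n, ∃ l, n < l.length ∧ StartsWith l z ∧ StartsWith l z') : z = z' := by
  funext n
  obtain ⟨l, hl, h1, h2⟩ := h n
  exact (h1.getElem hl).symm.trans (h2.getElem hl)

theorem take_eq_take_of_le {m n : ℕ} (h : m ≤ n) {z z' : Stream' A} (e : z.take n = z'.take n) :
    z.take m = z'.take m := by
  have := congrArg (List.take m) e
  simpa [take_take, h] using this

end Prefix

/-! ### Images of infinite words under nonerasing morphisms -/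

section Image

variable {A B C : Type*}

/-- The morphism given by its values on letters does not erase any letter. -/
def Nonerasing (φ : A → List B) : Prop := ∀ a, φ a ≠ []

theorem Nonerasing.length_le {φ : A → List B} (hφ : Nonerasing φ) (l : List A) :
    l.length ≤ (l.flatMap φ).length := by
  induction l with
  | nil => simp
  | cons a l ih =>
    have := List.length_pos_iff.2 (hφ a)
    simp only [List.length_cons, List.flatMap_cons, List.length_append]
    omega

theorem Nonerasing.flatMap_ne_nil {φ : A → List B} (hφ : Nonerasing φ) {l : List A}
    (hl : l ≠ []) : l.flatMap φ ≠ [] :=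
  List.length_pos_iff.1 ((List.length_pos_iff.2 hl).trans_le (hφ.length_le l))

/-- The image of an infinite word under a nonerasing morphism. -/
def image [Inhabited B] (φ : A → List B) (w : Stream' A) : Stream' B :=
  -- For nonerasing `φ`, the image of `n + 1` letters has length at least `n + 1`, so `default` is
  -- never reached.
  fun n => ((w.take (n + 1)).flatMap φ).getD n default

theorem flatMap_take_prefix (φ : A → List B) (w : Stream' A) {m n : ℕ} (h : m ≤ n) :
    (w.take m).flatMap φ <+: (w.take n).flatMap φ := by
  have : w.take m = (w.take n).take m := by rw [take_take, min_eq_right h]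
  rw [this]
  conv_rhs => rw [← List.take_append_drop m (w.take n)]
  rw [List.flatMap_append]
  exact List.prefix_append _ _

theorem Nonerasing.comp {φ : A → List B} {ψ : B → List C} (hφ : Nonerasing φ)
    (hψ : Nonerasing ψ) : Nonerasing fun a => (φ a).flatMap ψ :=
  fun a => hψ.flatMap_ne_nil (hφ a)

variable [Inhabited B]

theorem startsWith_image_take {φ : A → List B} (hφ : Nonerasing φ) (w : Stream' A) (n : ℕ) :
    StartsWith ((w.take n).flatMap φ) (image φ w) := by
  rw [startsWith_iff_get]
  intro i hi
  have hlt : i < ((w.take (i + 1)).flatMap φ).length := by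
    have := hφ.length_le (w.take (i + 1))
    rw [length_take] at this
    omega
  change _ = ((w.take (i + 1)).flatMap φ).getD i default
  rw [List.getD_eq_getElem _ _ hlt]
  rcases le_total n (i + 1) with h | h
  · exact (flatMap_take_prefix φ w h).getElem hi
  · exact ((flatMap_take_prefix φ w h).getElem hlt).symm

theorem StartsWith.image {φ : A → List B} (hφ : Nonerasing φ) {l : List A} {w : Stream' A}
    (h : StartsWith l w) : StartsWith (l.flatMap φ) (image φ w) := by
  have := startsWith_image_take hφ w l.length
  rwa [startsWith_iff_take.1 h] at this

theorem eq_image {φ : A → List B} (hφ : Nonerasing φ) {w : Stream' A} {z : Stream' B}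
    (h : ∀ n, ∃ m, n ≤ m ∧ StartsWith ((w.take m).flatMap φ) z) : z = image φ w := by
  refine eq_of_common_prefixes fun n => ?_
  obtain ⟨m, hm, h1⟩ := h (n + 1)
  refine ⟨_, ?_, h1, startsWith_image_take hφ w m⟩
  have := hφ.length_le (w.take m)
  rw [length_take] at this
  omega

theorem image_append {φ : A → List B} (hφ : Nonerasing φ) (l : List A) (w : Stream' A) :
    image φ (l ++ₛ w) = l.flatMap φ ++ₛ image φ w := by
  refine (eq_image hφ fun n => ⟨l.length + n, by omega, ?_⟩).symm
  rw [← append_take, List.flatMap_append]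
  exact (startsWith_image_take hφ w n).append _

theorem image_cons {φ : A → List B} (hφ : Nonerasing φ) (a : A) (w : Stream' A) :
    image φ (Stream'.cons a w) = φ a ++ₛ image φ w := by
  simpa using image_append hφ [a] w

theorem image_image [Inhabited C] {φ : A → List B} {ψ : B → List C} (hφ : Nonerasing φ) (hψ : Nonerasing ψ)
    (w : Stream' A) : image ψ (image φ w) = image (fun a => (φ a).flatMap ψ) w := by
  refine eq_image (hφ.comp hψ) fun n => ⟨n, le_rfl, ?_⟩
  have := (startsWith_image_take hφ w n).image hψ
  rwa [List.flatMap_assoc] at this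

theorem image_singleton (c : A → B) (w : Stream' A) : image (fun a => [c a]) w = w.map c := by
  refine (eq_image (fun _ => by simp) fun n => ⟨n, le_rfl, ?_⟩).symm
  rw [← List.map_eq_flatMap]
  conv_rhs => rw [← append_take_drop n w, map_append_stream]
  exact startsWith_append _ _

theorem take_image_congr {φ : A → List B} (hφ : Nonerasing φ) {n : ℕ} {w w' : Stream' A}
    (h : w.take n = w'.take n) : (image φ w).take n = (image φ w').take n := by
  have hl := hφ.length_le (w.take n)
  rw [length_take] at hl
  refine take_eq_take_of_le hl ?_
  rw [startsWith_iff_take.1 (startsWith_image_take hφ w n), h,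
    startsWith_iff_take.1 (startsWith_image_take hφ w' n)]

end Image

/-! ### Pure morphic words in terms of substitutions on lists -/

section PureMorphic

/-- `x` is the limit of the iterates on `a` of the morphism with values `φ` on letters. -/
structure IsLimit {A : Type*} (φ : A → List A) (a : A) (x : Stream' A) : Prop where
  exists_tail : ∃ u, φ a = a :: u ∧ ∀ n, (List.flatMap φ)^[n] u ≠ []
  startsWith : ∀ n, StartsWith ((List.flatMap φ)^[n] [a]) x

variable {A : Type*}

theorem toList_map_eq_flatMap (f : FreeMonoid A →* FreeMonoid A) (w : FreeMonoid A) :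
    (f w).toList = w.toList.flatMap fun a => (f (FreeMonoid.of a)).toList := by
  induction w using FreeMonoid.inductionOn' with
  | one => simp
  | of_mul a w ih => simp [ih]

theorem toList_iterate_eq_flatMap (f : FreeMonoid A →* FreeMonoid A) (n : ℕ) (w : FreeMonoid A) :
    (f^[n] w).toList
      = (List.flatMap fun a => (f (FreeMonoid.of a)).toList)^[n] w.toList := by
  induction n generalizing w with
  | zero => rfl
  | succ n ih => rw [Function.iterate_succ_apply, ih, toList_map_eq_flatMap,
      Function.iterate_succ_apply]

theorem isPrefix_iff_startsWith {w : FreeMonoid A} {x : ℕ → A} :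
    IsPrefix w x ↔ StartsWith w.toList x := by
  refine Iff.trans ?_ startsWith_iff_get.symm
  simp only [IsPrefix, OccursAt, Nat.zero_add]
  rfl

theorem isOmegaLimit_iff {f : FreeMonoid A →* FreeMonoid A} {a : A} {x : ℕ → A} :
    IsOmegaLimit f a x ↔ IsLimit (fun b => (f (FreeMonoid.of b)).toList) a x := by
  constructor
  · rintro ⟨⟨u, hu, -, hn⟩, hx⟩
    refine ⟨⟨u.toList, by rw [hu]; rfl, fun n h => hn n ?_⟩, fun n => ?_⟩
    · rw [← toList_iterate_eq_flatMap] at h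
      exact h
    · have := isPrefix_iff_startsWith.1 (hx n)
      rwa [toList_iterate_eq_flatMap] at this
  · rintro ⟨⟨u, hu, hn⟩, hx⟩
    refine ⟨⟨FreeMonoid.ofList u, hu, hn 0, fun n h => hn n ?_⟩, fun n => ?_⟩
    · have := toList_iterate_eq_flatMap f n (FreeMonoid.ofList u)
      rw [h] at this
      exact this.symm
    · rw [isPrefix_iff_startsWith, toList_iterate_eq_flatMap]
      exact hx n

theorem isPureMorphic_iff {x : ℕ → A} : IsPureMorphic x ↔ ∃ φ a, IsLimit φ a x := by
  constructor
  · rintro ⟨f, a, h⟩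
    exact ⟨_, a, isOmegaLimit_iff.1 h⟩
  · rintro ⟨φ, a, h⟩
    refine ⟨FreeMonoid.lift fun b => FreeMonoid.ofList (φ b), a, isOmegaLimit_iff.2 ?_⟩
    simpa using h

theorem flatMap_iterate_append (φ : A → List A) (n : ℕ) (l l' : List A) :
    (List.flatMap φ)^[n] (l ++ l') = (List.flatMap φ)^[n] l ++ (List.flatMap φ)^[n] l' := by
  induction n generalizing l l' with
  | zero => rfl
  | succ n ih => simp only [Function.iterate_succ_apply, List.flatMap_append, ih]

/-- Since `φ^{n+1}(a) = φ^n(a) φ^n(u)` and `φ^n(u)` is nonempty, each iteration adds a letter. -/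
theorem IsLimit.lt_length {φ : A → List A} {a : A} {x : Stream' A} (h : IsLimit φ a x) (n : ℕ) :
    n < ((List.flatMap φ)^[n] [a]).length := by
  obtain ⟨u, hu, hn⟩ := h.exists_tail
  induction n with
  | zero => simp
  | succ n ih =>
    have : List.flatMap φ [a] = [a] ++ u := by simp [hu]
    rw [Function.iterate_succ_apply, this, flatMap_iterate_append, List.length_append]
    have := List.length_pos_iff.2 (hn n)
    omega

theorem IsLimit.image_eq [Inhabited A] {φ : A → List A} {a : A} {x : Stream' A}
    (h : IsLimit φ a x) (hφ : Nonerasing φ) : image φ x = x := by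
  refine eq_of_common_prefixes fun n => ⟨_, ?_, (h.startsWith n).image hφ, ?_⟩
  · exact (h.lt_length n).trans_le (hφ.length_le _)
  · have := h.startsWith (n + 1)
    rwa [Function.iterate_succ_apply'] at this

end PureMorphic

/-! ### Images of morphic words -/

section Morphic

/-- The block of letters `(c, 0), …, (c, |h c| - 1)` spelling out `h c`. -/
def spell {C B : Type} (h : C → List B) (c : C) : List (Σ c : C, Fin (h c).length) :=
  (List.finRange (h c).length).map (Sigma.mk c)

/-- The morphism on spelled out letters induced by `φ`: the first letter of a block carries the
image of the whole block, the other ones are erased. -/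
def spellLift {C B : Type} (h : C → List B) (φ : C → List C) (p : Σ c : C, Fin (h c).length) :
    List (Σ c : C, Fin (h c).length) :=
  if p.2.1 = 0 then (φ p.1).flatMap (spell h) else []

section Spell

variable {C B : Type} {h : C → List B}

theorem spell_eq_cons (hh : Nonerasing h) (c : C) :
    ∃ l, spell h c = ⟨c, 0, List.length_pos_iff.2 (hh c)⟩ :: l ∧ ∀ p ∈ l, p.2.1 ≠ 0 := by
  obtain ⟨n, hn⟩ : ∃ n, (h c).length = n + 1 :=
    ⟨_, (Nat.succ_pred_eq_of_pos (List.length_pos_iff.2 (hh c))).symm⟩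
  refine ⟨(List.finRange n).map fun i => ⟨c, i.1 + 1, by omega⟩, ?_, ?_⟩
  · apply List.ext_getElem
    · simp [spell, hn]
    · intro i h1 h2
      rcases i with _ | i <;> simp [spell]
  · simp

theorem spell_nonerasing (hh : Nonerasing h) : Nonerasing (spell h) := by
  intro c
  obtain ⟨l, hl, -⟩ := spell_eq_cons hh c
  simp [hl]

theorem flatMap_spellLift_spell (hh : Nonerasing h) (φ : C → List C) (c : C) :
    (spell h c).flatMap (spellLift h φ) = (φ c).flatMap (spell h) := by
  obtain ⟨l, hl, h0⟩ := spell_eq_cons hh c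
  rw [hl, List.flatMap_cons]
  have : l.flatMap (spellLift h φ) = [] := by
    rw [List.flatMap_eq_nil_iff]
    intro p hp
    rw [spellLift, if_neg (h0 p hp)]
  rw [this, List.append_nil, spellLift, if_pos rfl]

theorem iterate_spellLift (hh : Nonerasing h) (φ : C → List C) (n : ℕ) (l : List C) :
    (List.flatMap (spellLift h φ))^[n] (l.flatMap (spell h))
      = ((List.flatMap φ)^[n] l).flatMap (spell h) := by
  induction n generalizing l with
  | zero => rfl
  | succ n ih =>
    rw [Function.iterate_succ_apply, Function.iterate_succ_apply, ← ih, List.flatMap_assoc,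
      List.flatMap_assoc]
    simp only [flatMap_spellLift_spell hh]

theorem spell_map (c : C) : (spell h c).map (fun p => (h p.1)[p.2]) = h c := by
  apply List.ext_getElem <;> simp [spell]

/-- The image of a pure morphic word under a nonerasing morphism is morphic. -/
theorem IsLimit.isMorphic_image [Finite C] [Inhabited B] {φ : C → List C} {a : C} {x : Stream' C}
    (hx : IsLimit φ a x) (hh : Nonerasing h) : IsMorphic (image h x) := by
  have hpos := List.length_pos_iff.2 (hh a)
  let a₀ : Σ c : C, Fin (h c).length := ⟨a, 0, hpos⟩
  have : Inhabited (Σ c : C, Fin (h c).length) := ⟨a₀⟩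
  have hsp := spell_nonerasing hh
  refine ⟨_, inferInstance, image (spell h) x, fun p => (h p.1)[p.2],
    isPureMorphic_iff.2 ⟨spellLift h φ, a₀, ?_, ?_⟩, ?_⟩
  · obtain ⟨u, hu, hn⟩ := hx.exists_tail
    obtain ⟨l, hl, -⟩ := spell_eq_cons hh a
    -- The letters of `l` are erased at the next step; the tail survives because of `u`.
    refine ⟨l ++ u.flatMap (spell h), ?_, fun n => ?_⟩
    · rw [spellLift, if_pos rfl, hu, List.flatMap_cons, hl, List.cons_append]
    · rw [flatMap_iterate_append, iterate_spellLift hh]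
      exact fun e => hsp.flatMap_ne_nil (hn n) (List.append_eq_nil_iff.1 e).2
  · intro n
    obtain ⟨l, hl, -⟩ := spell_eq_cons hh a
    -- Only at `n = 0` is the iterate shorter than a full spelled block: `a₀` alone already carries
    -- the image of all of `spell h a`.
    rcases n with _ | n
    · have := (hx.startsWith 0).image hsp
      simp only [Function.iterate_zero, id, List.flatMap_cons, hl] at this
      exact StartsWith.of_append (l' := l ++ List.flatMap (spell h) []) this
    · have := (hx.startsWith (n + 1)).image hsp
      rw [Function.iterate_succ_apply, ← iterate_spellLift hh] at this
      rw [Function.iterate_succ_apply]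
      have e : List.flatMap (spellLift h φ) [a₀] = (List.flatMap φ [a]).flatMap (spell h) := by
        simp [spellLift, a₀]
      rwa [e]
  · have := image_image hsp (ψ := fun p => [(h p.1)[p.2]]) (fun _ => by simp) x
    rw [image_singleton] at this
    refine Eq.trans ?_ this.symm
    congr 1
    funext c
    rw [← List.map_eq_flatMap, spell_map]

end Spell

/-- The word `u φ(u) ⋯ φ^{n-1}(u)`. -/
def geomWord {A : Type*} (φ : A → List A) (u : List A) : ℕ → List A
  | 0 => []
  | n + 1 => u ++ (geomWord φ u n).flatMap φ

/-- The morphism on `Option A` with `none ↦ none u`, extending `φ`. -/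
def optionLift {A : Type*} (φ : A → List A) (u : List A) : Option A → List (Option A)
  | none => none :: u.map some
  | some a => (φ a).map some

theorem iterate_optionLift_map_some {A : Type*} (φ : A → List A) (u l : List A) (n : ℕ) :
    (List.flatMap (optionLift φ u))^[n] (l.map some) = ((List.flatMap φ)^[n] l).map some := by
  induction n generalizing l with
  | zero => rfl
  | succ n ih =>
    rw [Function.iterate_succ_apply, Function.iterate_succ_apply, ← ih]
    congr 1
    rw [List.flatMap_map, List.map_flatMap]
    rfl

/-- The fresh letter `none` emits one more term of `u φ(u) φ²(u) ⋯` at each step, making this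
product, preceded by `none`, pure morphic. -/
theorem iterate_optionLift_none {A : Type*} (φ : A → List A) (u : List A) (n : ℕ) :
    (List.flatMap (optionLift φ u))^[n] [none] = none :: (geomWord φ u n).map some := by
  induction n with
  | zero => rfl
  | succ n ih =>
    rw [Function.iterate_succ_apply', ih, List.flatMap_cons, geomWord, List.map_append,
      List.flatMap_map, List.map_flatMap]
    rfl

variable {B C : Type} [Inhabited B] [Finite C]

/-- If `t` is the infinite word `u φ(u) φ²(u) ⋯`, then the words `p h(t)` are morphic. -/
theorem isMorphic_append_image_of_geomWord {φ : C → List C} {u : List C} {t : Stream' C}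
    (hu : ∀ n, (List.flatMap φ)^[n] u ≠ []) (ht : ∀ n, StartsWith (geomWord φ u n) t)
    {h : C → List B} (hh : Nonerasing h) {p : List B} (hp : p ≠ []) :
    IsMorphic (p ++ₛ image h t) := by
  have hlim : IsLimit (optionLift φ u) none (Stream'.cons none (t.map some)) := by
    refine ⟨⟨u.map some, rfl, fun n => ?_⟩, fun n => ?_⟩
    · rw [iterate_optionLift_map_some]
      simpa using hu n
    · rw [iterate_optionLift_none]
      obtain ⟨z, hz⟩ := ht n
      refine ⟨z.map some, ?_⟩
      rw [hz, map_append_stream]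
      rfl
  -- The marker `none` is replaced by `p`; nonemptiness of `p` keeps `k` nonerasing.
  let k : Option C → List B := fun o => o.elim p h
  have hk : Nonerasing k := by
    rintro (_ | c)
    · exact hp
    · exact hh c
  have := hlim.isMorphic_image hk
  rw [image_cons hk] at this
  have i : Inhabited (Option C) := ⟨none⟩
  have e : (fun c => List.flatMap k [some c]) = h := by
    funext c
    simp [k]
  rwa [← image_singleton, image_image (fun _ => by simp) hk, e] at this

theorem IsLimit.exists_tail_geomWord {A : Type*} {φ : A → List A} {a : A} {x : Stream' A}
    (h : IsLimit φ a x) : ∃ u t, (∀ n, (List.flatMap φ)^[n] u ≠ []) ∧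
      (∀ n, StartsWith (geomWord φ u n) t) ∧ x = Stream'.cons a t := by
  obtain ⟨u, hu, hn⟩ := h.exists_tail
  have key : ∀ n, (List.flatMap φ)^[n] [a] = a :: geomWord φ u n := by
    intro n
    induction n with
    | zero => rfl
    | succ n ih => rw [Function.iterate_succ_apply', ih, List.flatMap_cons, hu, geomWord,
        List.cons_append]
  have hx : x = Stream'.cons a x.tail := by
    obtain ⟨z, hz⟩ := h.startsWith 0
    rw [hz]
    rfl
  refine ⟨u, x.tail, hn, fun n => ?_, hx⟩
  obtain ⟨z, hz⟩ := h.startsWith n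
  refine ⟨z, ?_⟩
  rw [hz, key]
  rfl

theorem IsMorphic.append_image {A : Type} {x : Stream' A} [Inhabited A] (hx : IsMorphic x)
    {h : A → List B} (hh : Nonerasing h) (p : List B) : IsMorphic (p ++ₛ image h x) := by
  obtain ⟨D, _, z, c, hz, hxz⟩ := hx
  obtain ⟨φ, a, hlim⟩ := isPureMorphic_iff.1 hz
  obtain ⟨u, t, hu, ht, rfl⟩ := hlim.exists_tail_geomWord
  have hc : Nonerasing fun d => h (c d) := fun d => hh _
  -- The image of the first letter joins the prefix, which is then nonempty even when `p` is empty.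
  have := isMorphic_append_image_of_geomWord hu ht hc (p := p ++ h (c a)) (by simp [hh (c a)])
  convert this using 1
  have e : x = image (fun d => [c d]) (Stream'.cons a t) := by
    rw [image_singleton, hxz]
    rfl
  rw [append_append_stream, e, image_image (fun _ => by simp) hh, image_cons]
  · simp
  · intro d
    simp [hh (c d)]

theorem IsMorphic.append {A : Type} [Inhabited A] {x : Stream' A} (hx : IsMorphic x)
    (p : List A) : IsMorphic (p ++ₛ x) := by
  have := hx.append_image (h := fun a => [a]) (fun _ => by simp) p
  rw [image_singleton (fun a => a) x] at this
  exact this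

/-- Purely periodic words are morphic. -/
theorem isMorphic_of_periodic {x : Stream' B} {p : ℕ} (hp : 0 < p) (h : x.drop p = x) :
    IsMorphic x := by
  let t : Stream' Unit := fun _ => ()
  have ht : Stream'.cons () t = t := rfl
  have hne : Nonerasing fun _ : Unit => x.take p := fun _ e => by
    have := congrArg List.length e
    rw [length_take, List.length_nil] at this
    omega
  have himg : image (fun _ : Unit => x.take p) t = x := by
    symm
    refine eq_image hne fun n => ⟨n, le_rfl, ?_⟩
    induction n with
    | zero => exact ⟨x, rfl⟩
    | succ n ih =>
      rw [← ht, Stream'.take_succ_cons, List.flatMap_cons]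
      have := ih.append (x.take p)
      nth_rewrite 4 [← h] at this
      rwa [append_take_drop] at this
  -- Over a one-letter alphabet with the identity morphism, the product is constant, and its letter
  -- is mapped to the period.
  have := isMorphic_append_image_of_geomWord (φ := fun a : Unit => [a]) (u := [()]) (t := t)
    (fun n => by simp [Function.iterate_fixed]) (fun n => startsWith_iff_get.2 fun _ _ => rfl)
    hne (hne ())
  rwa [← image_cons hne, ht, himg] at this

theorem isMorphic_const (b : B) : IsMorphic fun _ : ℕ => b :=
  isMorphic_of_periodic (x := fun _ => b) one_pos rfl

theorem startsWith_geomWord {A : Type*} [Inhabited A] {φ : A → List A} (hφ : Nonerasing φ)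
    {u : List A} {v : Stream' A} (h : v = u ++ₛ image φ v) (n : ℕ) :
    StartsWith (geomWord φ u n) v := by
  induction n with
  | zero => exact ⟨v, rfl⟩
  | succ n ih =>
    have := (ih.image hφ).append u
    rwa [← h] at this

theorem Nonerasing.iterate_ne_nil {A : Type*} {φ : A → List A} (hφ : Nonerasing φ)
    {u : List A} (hu : u ≠ []) (n : ℕ) : (List.flatMap φ)^[n] u ≠ [] := by
  induction n with
  | zero => exact hu
  | succ n ih =>
    rw [Function.iterate_succ_apply']
    exact hφ.flatMap_ne_nil ih

/-- Over a binary alphabet, the solutions `v` of `v = r φ(v)` are morphic when `φ` is nonerasing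
and is not the identity. -/
theorem isMorphic_of_eq_append_image {φ : Fin 2 → List (Fin 2)} (hφ : Nonerasing φ) {a : Fin 2}
    (ha : (φ a).length ≠ 1) {r : List (Fin 2)} {v : Stream' (Fin 2)} (h : v = r ++ₛ image φ v) :
    IsMorphic v := by
  have main : ∀ {u : List (Fin 2)} {t : Stream' (Fin 2)}, u ≠ [] → t = u ++ₛ image φ t →
      ∀ p : List (Fin 2), p ≠ [] → IsMorphic (p ++ₛ t) := fun {u t} hu ht p hp => by
    have := isMorphic_append_image_of_geomWord (hφ.iterate_ne_nil hu) (startsWith_geomWord hφ ht)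
      (h := fun b => [b]) (fun _ => by simp) hp
    rw [image_singleton (fun b => b)] at this
    exact this
  by_cases hr : r = []
  · subst hr
    change v = image φ v at h
    by_cases hall : ∀ n, (φ (v.get n)).length = 1
    · have hc : v = fun _ => v.get 0 := by
        funext n
        have h1 : v.get n ≠ a := fun e => ha (e ▸ hall n)
        have h2 : v.get 0 ≠ a := fun e => ha (e ▸ hall 0)
        change v.get n = v.get 0
        omega
      rw [hc]
      exact isMorphic_const _
    · push Not at hall
      classical
      have hlt : ∀ m < Nat.find hall, (φ (v.get m)).length = 1 := fun m hm =>
        not_not.1 (Nat.find_min hall hm)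
      have hspec := Nat.find_spec hall
      set n := Nat.find hall
      -- Before the first letter with a longer image, every letter has a one-letter image, so it can
      -- be cancelled from both sides of `v = φ(v)`.
      have hfix : ∀ m ≤ n, v.drop m = image φ (v.drop m) := by
        intro m hm
        induction m with
        | zero => exact h
        | succ m ih =>
          have e := ih (by omega)
          rw [← Stream'.eta (v.drop m), image_cons hφ] at e
          obtain ⟨d, hd⟩ := List.length_eq_one_iff.1 (hlt m (by omega))
          rw [Stream'.head_drop, hd] at e
          rw [← Stream'.tail_drop']
          exact congrArg Stream'.tail e
      have e := hfix n le_rfl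
      rw [← Stream'.eta (v.drop n), image_cons hφ, Stream'.head_drop] at e
      obtain ⟨b, u, hbu⟩ := List.exists_cons_of_ne_nil (hφ (v.get n))
      rw [hbu] at e hspec
      have hu : u ≠ [] := by
        rintro rfl
        simp at hspec
      -- Dropping the head leaves `t = u φ(t)` with `u` nonempty, the case covered by `main`.
      have e2 := congrArg Stream'.tail e
      have := main hu e2 (v.take (n + 1)) (by simp [Stream'.take_succ])
      have e3 : (v.drop n).tail = v.drop (n + 1) := by simp
      change IsMorphic (v.take (n + 1) ++ₛ (v.drop n).tail) at this
      rwa [e3, append_take_drop] at this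
  · obtain ⟨b, u, rfl⟩ := List.exists_cons_of_ne_nil hr
    have := isMorphic_append_image_of_geomWord (hφ.iterate_ne_nil hr) (startsWith_geomWord hφ h)
      hφ hr
    rwa [← h] at this

end Morphic

/-! ### The shift orbit closure -/

section Closure

variable {A : Type*}

theorem take_eq_take_of_get {n : ℕ} {y z : Stream' A} (h : ∀ t < n, y.get t = z.get t) :
    y.take n = z.take n := by
  refine List.ext_getElem (by simp) fun t h1 h2 => ?_
  have ht : t < n := by simpa using h1
  rw [(startsWith_take n y).getElem h1, (startsWith_take n z).getElem h2, h t ht]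

theorem get_eq_get_of_take {n t : ℕ} {y z : Stream' A} (h : y.take n = z.take n) (ht : t < n) :
    y.get t = z.get t := by
  have e := getElem?_take (s := y) ht
  rw [h, getElem?_take ht] at e
  exact (Option.some.inj e).symm

theorem mem_shiftOrbitClosure_iff {x y : Stream' A} :
    y ∈ shiftOrbitClosure x ↔ ∀ n, ∃ k, y.take n = (x.drop k).take n := by
  constructor
  · intro h n
    obtain ⟨k, hk⟩ := @h (FreeMonoid.ofList (y.take n)) ⟨0, fun i hi => by
      rw [Nat.zero_add]
      exact (startsWith_take n y).getElem hi⟩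
    refine ⟨k, ?_⟩
    have h1 : StartsWith (y.take n) (x.drop k) := startsWith_iff_get.2 fun i hi => by
      rw [Stream'.get_drop]
      exact hk i hi
    have := startsWith_iff_take.1 h1
    rw [length_take] at this
    exact this.symm
  · rintro h w ⟨n, hn⟩
    obtain ⟨k, hk⟩ := h (n + w.toList.length)
    refine ⟨k + n, fun i hi => ?_⟩
    rw [hn i hi]
    have h1 : n + i < n + w.toList.length := by omega
    have e := get_eq_get_of_take hk h1
    rwa [Stream'.get_drop, ← add_assoc] at e

theorem drop_mem_shiftOrbitClosure {x y : Stream' A} (h : y ∈ shiftOrbitClosure x) (j : ℕ) :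
    y.drop j ∈ shiftOrbitClosure x := by
  rintro w ⟨n, hn⟩
  refine h ⟨j + n, fun i hi => ?_⟩
  rw [hn i hi, add_assoc]
  change y.get (n + i + j) = y.get (j + (n + i))
  rw [add_comm]

/-- A factor of `w` found in `x` at `k` has its image in `φ(x) = x` at position `|φ(x_0 ⋯
x_{k-1})|`. -/
theorem image_mem_shiftOrbitClosure [Inhabited A] {φ : A → List A} (hφ : Nonerasing φ)
    {x w : Stream' A} (hx : image φ x = x) (hw : w ∈ shiftOrbitClosure x) :
    image φ w ∈ shiftOrbitClosure x := by
  rw [mem_shiftOrbitClosure_iff] at hw ⊢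
  intro n
  obtain ⟨k, hk⟩ := hw n
  refine ⟨((x.take k).flatMap φ).length, ?_⟩
  rw [take_image_congr hφ hk]
  congr 1
  rw [← drop_append_stream ((x.take k).flatMap φ) (image φ (x.drop k)), ← image_append hφ,
    append_take_drop, hx]

theorem drop_eq_of_mem_shiftOrbitClosure {x y : Stream' A} {p : ℕ} (hx : x.drop p = x)
    (hy : y ∈ shiftOrbitClosure x) : y.drop p = y := by
  rw [mem_shiftOrbitClosure_iff] at hy
  funext i
  obtain ⟨k, hk⟩ := hy (p + i + 1)
  have get_eq : ∀ m < p + i + 1, y.get m = x.get (k + m) := fun m hm => by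
    rw [← Stream'.get_drop]
    exact get_eq_get_of_take hk hm
  have h1 : (y.drop p).get i = y.get i := by
    rw [Stream'.get_drop, get_eq _ (by omega), get_eq i (by omega)]
    nth_rewrite 2 [← hx]
    rw [Stream'.get_drop]
    congr 1
    omega
  exact h1

/-- If all images of letters commute with the image of the first letter, then the limit is
periodic. -/
theorem IsLimit.drop_eq {φ : A → List A} {a : A} {x : Stream' A} (h : IsLimit φ a x)
    (hcomm : ∀ b, φ a ++ φ b = φ b ++ φ a) : x.drop (φ a).length = x := by
  have hc : ∀ l : List A, φ a ++ l.flatMap φ = l.flatMap φ ++ φ a := by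
    intro l
    induction l with
    | nil => simp
    | cons b l ih =>
      rw [List.flatMap_cons, ← List.append_assoc, hcomm, List.append_assoc, ih,
        List.append_assoc]
  funext i
  set p := (φ a).length
  set l := (List.flatMap φ)^[p + i + 1] [a] with hl
  have hlen : p + i + 1 < l.length := h.lt_length _
  have hs := h.startsWith (p + i + 1)
  have hcl : φ a ++ l = l ++ φ a := by
    rw [hl, Function.iterate_succ_apply']
    exact hc _
  -- Comparing position `p + i` in `φ a ++ l` and `l ++ φ a` gives `l[i] = l[p + i]`.
  have e1 : (φ a ++ l)[p + i]? = l[i]? := by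
    rw [List.getElem?_append_right (by omega)]
    congr 1
    omega
  rw [hcl, List.getElem?_append_left (by omega), List.getElem?_eq_getElem (by omega),
    List.getElem?_eq_getElem (by omega), Option.some_inj, hs.getElem, hs.getElem] at e1
  have : (x.drop p).get i = x.get i := by rw [Stream'.get_drop, e1]
  exact this

/-- Every position of an infinite image lies in the image of a letter. -/
theorem exists_block {B : Type*} [Inhabited B] {φ : A → List B} (hφ : Nonerasing φ)
    (x : Stream' A) (k : ℕ) :
    ∃ m j, j < (φ (x.get m)).length ∧
      (image φ x).drop k = (image φ (x.drop m)).drop j := by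
  induction k with
  | zero => exact ⟨0, 0, List.length_pos_iff.2 (hφ _), rfl⟩
  | succ k ih =>
    obtain ⟨m, j, hj, e⟩ := ih
    have e' : (image φ x).drop (k + 1) = (image φ (x.drop m)).drop (j + 1) := by
      rw [← Stream'.drop_drop, e, Stream'.drop_drop]
    by_cases hj' : j + 1 < (φ (x.get m)).length
    · exact ⟨m, j + 1, hj', e'⟩
    · refine ⟨m + 1, 0, List.length_pos_iff.2 (hφ _), ?_⟩
      have : j + 1 = (φ (x.get m)).length := by omega
      rw [e', this, ← Stream'.eta (x.drop m), image_cons hφ, Stream'.head_drop,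
        drop_append_stream]
      simp

/-- Desubstitution: a word in the shift orbit closure of a fixed point of a nonerasing morphism
is a suffix of the image of another such word, starting within the image of the first letter. -/
theorem exists_drop_image_eq [Finite A] [Inhabited A] {φ : A → List A} (hφ : Nonerasing φ)
    {x y : Stream' A} (hx : image φ x = x) (hy : y ∈ shiftOrbitClosure x) :
    ∃ w : Stream' A, w ∈ shiftOrbitClosure x ∧ ∃ j < (φ (w.get 0)).length, y = (image φ w).drop j := by
  rw [mem_shiftOrbitClosure_iff] at hy
  choose k hk using hy
  choose m j hj hmj using fun n => exists_block hφ x (k n)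
  rw [hx] at hmj
  obtain ⟨N, hN⟩ : ∃ N, ∀ a, (φ a).length ≤ N := by
    obtain ⟨N, hN⟩ := (Set.finite_range fun a => (φ a).length).bddAbove
    exact ⟨N, fun a => hN ⟨a, rfl⟩⟩
  let : TopologicalSpace A := ⊥
  have : DiscreteTopology A := ⟨rfl⟩
  -- Block lengths are bounded by `N`, so pairs (suffix of `x`, cut offset) live in a compact space;
  -- a limit point supplies `w` and the cut.
  let s : ℕ → (ℕ → A) × Fin (N + 1) := fun n =>
    (x.drop (m n), ⟨j n, (hj n).trans_le ((hN _).trans (Nat.le_succ N))⟩)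
  obtain ⟨⟨w', i⟩, ψ, hψ, hlim⟩ := CompactSpace.tendsto_subseq s
  obtain ⟨w, rfl⟩ : ∃ w : Stream' A, w = w' := ⟨w', rfl⟩
  rw [Prod.tendsto_iff, tendsto_pi_nhds] at hlim
  obtain ⟨h1, h2⟩ := hlim
  simp only [nhds_discrete, Filter.tendsto_pure] at h1 h2
  have hev : ∀ n, ∃ r, n ≤ r ∧ j r = i.1 ∧ ∀ t < n, (x.drop (m r)).get t = w.get t := by
    intro n
    have h3 : ∀ᶠ q in Filter.atTop, ∀ t ∈ Finset.range n, (s (ψ q)).1 t = w t :=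
      (Filter.eventually_all_finset _).2 fun t _ => h1 t
    obtain ⟨q, hq1, hq2, hq3⟩ := (h2.and (h3.and (Filter.eventually_ge_atTop n))).exists
    exact ⟨ψ q, hq3.trans (hψ.id_le q), congrArg Fin.val hq1,
      fun t ht => hq2 t (Finset.mem_range.2 ht)⟩
  refine ⟨w, mem_shiftOrbitClosure_iff.2 fun n => ?_, i, ?_, ?_⟩
  · obtain ⟨r, -, -, hr⟩ := hev n
    exact ⟨m r, (take_eq_take_of_get hr).symm⟩
  · obtain ⟨r, -, hr, hr'⟩ := hev 1
    have := hj r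
    rw [hr] at this
    have e := hr' 0 one_pos
    rw [Stream'.get_drop, add_zero] at e
    change _ < (φ (w.get 0)).length
    rwa [← e]
  · refine Stream'.take_theorem _ _ fun n => ?_
    -- The extra `i` letters make up for those removed by the cut.
    obtain ⟨r, hr1, hr2, hr3⟩ := hev (i.1 + n)
    have e1 : y.take n = (x.drop (k r)).take n := take_eq_take_of_le (by omega) (hk r)
    have e2 := take_image_congr hφ (take_eq_take_of_get hr3)
    rw [e1, hmj, hr2]
    refine take_eq_take_of_get fun t ht => ?_
    rw [Stream'.get_drop, Stream'.get_drop]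
    exact get_eq_get_of_take (t := i.1 + t) e2 (by omega)

end Closure

/-! ### Noncommuting words and the lexicographic order -/

section Separation

variable {A : Type*}

theorem exists_first_difference {u v : List A} (h1 : ¬ u <+: v) (h2 : ¬ v <+: u) :
    ∃ p a b r s, a ≠ b ∧ u = p ++ [a] ++ r ∧ v = p ++ [b] ++ s := by
  induction u generalizing v with
  | nil => exact absurd v.nil_prefix h1
  | cons a u ih =>
    rcases v with _ | ⟨b, v⟩
    · exact absurd (List.nil_prefix) h2
    · by_cases hab : a = b
      · subst hab
        rw [List.prefix_cons_inj] at h1 h2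
        obtain ⟨p, c, d, r, s, hcd, rfl, rfl⟩ := ih h1 h2
        exact ⟨a :: p, c, d, r, s, hcd, rfl, rfl⟩
      · exact ⟨[], a, b, u, v, hab, rfl, rfl⟩

/-- If `u v ≠ v u`, then the infinite products of `u` and `v` starting with `u` and those starting
with `v` all separate at the same place. -/
theorem exists_separating (N : ℕ) : ∀ u v : List A, u.length + v.length ≤ N → u ++ v ≠ v ++ u →
    ∀ Z : Set (Stream' A), (∀ z ∈ Z, ∃ z' ∈ Z, z = u ++ₛ z' ∨ z = v ++ₛ z') →
    ∃ p a b, a ≠ b ∧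
      ∀ z ∈ Z, StartsWith (p ++ [a]) (u ++ₛ z) ∧ StartsWith (p ++ [b]) (v ++ₛ z) := by
  induction N with
  | zero =>
    intro u v h huv
    have hu : u = [] := List.length_eq_zero_iff.1 (by omega)
    subst hu
    simp at huv
  | succ N ih =>
    have aux : ∀ u v : List A, u.length + v.length ≤ N + 1 → u ++ v ≠ v ++ u → u <+: v →
        ∀ Z : Set (Stream' A), (∀ z ∈ Z, ∃ z' ∈ Z, z = u ++ₛ z' ∨ z = v ++ₛ z') →
        ∃ p a b, a ≠ b ∧
          ∀ z ∈ Z, StartsWith (p ++ [a]) (u ++ₛ z) ∧ StartsWith (p ++ [b]) (v ++ₛ z) := by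
      rintro u _ hN huv ⟨v, rfl⟩ Z hZ
      have hu : 0 < u.length := by
        rw [List.length_pos_iff]
        rintro rfl
        simp at huv
      rw [List.length_append] at hN
      have huv' : u ++ v ≠ v ++ u := fun e => huv (by
        rw [List.append_assoc u v u, ← e])
      -- Euclidean step: the pair `u`, `u v` is replaced by `u`, `v`. Adding `v Z` to `Z` keeps the
      -- set closed under splitting off a factor, since `u v z = u (v z)`.
      obtain ⟨p, a, b, hab, hp⟩ := ih u v (by omega) huv' (Z ∪ (fun z => v ++ₛ z) '' Z) (by
        rintro z (hz | ⟨z, hz, rfl⟩)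
        · obtain ⟨z', hz', rfl | rfl⟩ := hZ z hz
          · exact ⟨z', Or.inl hz', Or.inl rfl⟩
          · exact ⟨v ++ₛ z', Or.inr ⟨z', hz', rfl⟩, Or.inl (append_append_stream _ _ _)⟩
        · exact ⟨z, Or.inl hz, Or.inr rfl⟩)
      refine ⟨u ++ p, a, b, hab, fun z hz => ⟨?_, ?_⟩⟩
      · rw [List.append_assoc]
        obtain ⟨z', hz', rfl | rfl⟩ := hZ z hz
        · exact (hp z' (Or.inl hz')).1.append u
        · rw [append_append_stream]
          exact (hp _ (Or.inr ⟨z', hz', rfl⟩)).1.append u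
      · rw [List.append_assoc, append_append_stream]
        exact (hp z (Or.inl hz)).2.append u
    intro u v hN huv Z hZ
    by_cases h1 : u <+: v
    · exact aux u v hN huv h1 Z hZ
    by_cases h2 : v <+: u
    · obtain ⟨p, a, b, hab, hp⟩ := aux v u (by omega) huv.symm h2 Z fun z hz => by
        obtain ⟨z', hz', h⟩ := hZ z hz
        exact ⟨z', hz', h.symm⟩
      exact ⟨p, b, a, hab.symm, fun z hz => (hp z hz).symm⟩
    obtain ⟨p, a, b, r, s, hab, rfl, rfl⟩ := exists_first_difference h1 h2
    refine ⟨p, a, b, hab, fun z _ => ?_⟩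
    rw [append_append_stream _ r, append_append_stream _ s]
    exact ⟨startsWith_append _ _, startsWith_append _ _⟩

end Separation

section Order

/-- The strict lexicographic order on binary words for which `m` is the smaller letter. -/
def BinLT (m : Fin 2) (y z : Stream' (Fin 2)) : Prop :=
  ∃ n, (∀ i < n, y.get i = z.get i) ∧ y.get n = m ∧ z.get n ≠ m

theorem BinLT.irrefl {m : Fin 2} {y : Stream' (Fin 2)} : ¬ BinLT m y y :=
  fun ⟨_, _, h1, h2⟩ => h2 h1

theorem BinLT.asymm {m : Fin 2} {y z : Stream' (Fin 2)} (h : BinLT m y z) : ¬ BinLT m z y := by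
  obtain ⟨n, h1, h2, h3⟩ := h
  rintro ⟨k, h4, h5, h6⟩
  rcases lt_trichotomy n k with h | rfl | h
  · exact h3 ((h4 n h).trans h2)
  · exact h3 h5
  · exact h6 ((h1 k h).trans h5)

theorem binLT_trichotomy (m : Fin 2) (y z : Stream' (Fin 2)) :
    y = z ∨ BinLT m y z ∨ BinLT m z y := by
  classical
  by_cases h : ∃ n, y.get n ≠ z.get n
  · right
    have hlt : ∀ i < Nat.find h, y.get i = z.get i := fun i hi => not_not.1 (Nat.find_min h hi)
    have hne := Nat.find_spec h
    by_cases hm : y.get (Nat.find h) = m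
    · exact Or.inl ⟨_, hlt, hm, fun e => hne (hm.trans e.symm)⟩
    · refine Or.inr ⟨_, fun i hi => (hlt i hi).symm, ?_, hm⟩
      omega
  · push Not at h
    exact Or.inl (funext h)

theorem BinLT.drop {m : Fin 2} {y z : Stream' (Fin 2)} (h : BinLT m y z) {j : ℕ}
    (hj : ∀ i < j, y.get i = z.get i) : BinLT m (y.drop j) (z.drop j) := by
  obtain ⟨n, h1, h2, h3⟩ := h
  have hn : j ≤ n := by
    by_contra hlt
    exact h3 ((hj n (by omega)).symm.trans h2)
  obtain ⟨k, rfl⟩ := Nat.exists_eq_add_of_le hn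
  refine ⟨k, fun i hi => ?_, ?_, ?_⟩
  · rw [Stream'.get_drop, Stream'.get_drop]
    exact h1 _ (by omega)
  · rwa [Stream'.get_drop]
  · rwa [Stream'.get_drop]

theorem binLT_append {m e : Fin 2} (he : e ≠ m) (l : List (Fin 2)) {y z : Stream' (Fin 2)}
    (hy : StartsWith (l ++ [m]) y) (hz : StartsWith (l ++ [e]) z) : BinLT m y z := by
  refine ⟨l.length, fun i hi => ?_, ?_, ?_⟩
  · rw [← hy.of_append.getElem hi, ← hz.of_append.getElem hi]
  · rw [← hy.getElem (by simp)]
    simp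
  · rw [← hz.getElem (by simp)]
    simpa using he

/-- A binary morphism whose images of letters do not commute preserves or reverses the
lexicographic order. -/
theorem exists_image_binLT {φ : Fin 2 → List (Fin 2)} (hφ : Nonerasing φ)
    (hcomm : φ 0 ++ φ 1 ≠ φ 1 ++ φ 0) (m : Fin 2) :
    ∃ m', ∀ w w', BinLT m' w w' → BinLT m (image φ w) (image φ w') := by
  obtain ⟨p, a, b, hab, hp⟩ := exists_separating _ _ _ le_rfl hcomm (Set.range (image φ)) (by
    rintro _ ⟨w, rfl⟩
    refine ⟨image φ w.tail, ⟨_, rfl⟩, ?_⟩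
    have e : image φ w = φ w.head ++ₛ image φ w.tail := by
      rw [← image_cons hφ, Stream'.eta]
    rw [e]
    generalize w.head = c
    fin_cases c
    · exact Or.inl rfl
    · exact Or.inr rfl)
  -- `m'` is the letter whose block is followed through `p` by `m`; it differs from `m` exactly when
  -- `φ` reverses the order.
  obtain ⟨m', hm1, e, he, hm2⟩ : ∃ m', (∀ w, StartsWith (p ++ [m]) (φ m' ++ₛ image φ w)) ∧
      ∃ e ≠ m, ∀ c ≠ m', ∀ w, StartsWith (p ++ [e]) (φ c ++ₛ image φ w) := by
    by_cases ham : a = m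
    · subst ham
      refine ⟨0, fun w => (hp _ ⟨w, rfl⟩).1, b, hab.symm, fun c hc w => ?_⟩
      obtain rfl : c = 1 := by omega
      exact (hp _ ⟨w, rfl⟩).2
    · obtain rfl : b = m := by omega
      refine ⟨1, fun w => (hp _ ⟨w, rfl⟩).2, a, hab, fun c hc w => ?_⟩
      obtain rfl : c = 0 := by omega
      exact (hp _ ⟨w, rfl⟩).1
  refine ⟨m', ?_⟩
  rintro w w' ⟨n, h1, h2, h3⟩
  have e1 := append_take_drop n w
  have e2 := append_take_drop n w'
  rw [← Stream'.eta (w.drop n), Stream'.head_drop, h2] at e1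
  rw [← Stream'.eta (w'.drop n), Stream'.head_drop, ← take_eq_take_of_get h1] at e2
  rw [← e1, ← e2, image_append hφ, image_append hφ, image_cons hφ, image_cons hφ]
  apply binLT_append he ((w.take n).flatMap φ ++ p)
  · rw [List.append_assoc]
    exact (hm1 _).append _
  · rw [List.append_assoc]
    exact (hm2 _ h3 _).append _

end Order

/-! ### Extremal words -/

section Extremal

/-- `y` is the smallest word beginning with `b` in the shift orbit closure of `x`, for the order
with smaller letter `m`. -/
structure IsBinLeast (m b : Fin 2) (x y : Stream' (Fin 2)) : Prop where
  mem : y ∈ shiftOrbitClosure x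
  get_zero : y.get 0 = b
  eq_or_lt : ∀ z : Stream' (Fin 2), z ∈ shiftOrbitClosure x → z.get 0 = b → y = z ∨ BinLT m y z

theorem IsBinLeast.unique {m b : Fin 2} {x y z : Stream' (Fin 2)} (hy : IsBinLeast m b x y)
    (hz : IsBinLeast m b x z) : y = z := by
  rcases hy.eq_or_lt z hz.mem hz.get_zero with h | h
  · exact h
  · rcases hz.eq_or_lt y hy.mem hy.get_zero with h' | h'
    · exact h'.symm
    · exact absurd h' h.asymm

/-- On two letters a total order amounts to the choice of its smaller letter. -/
theorem IsExtremal.exists_isBinLeast {x y : ℕ → Fin 2} (h : IsExtremal x y) :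
    ∃ m b, IsBinLeast m b x y := by
  obtain ⟨σ, b, -, ⟨hy, hb⟩, hmin⟩ := h
  obtain ⟨m, hm⟩ : ∃ m, ∀ p q, σ.lt p q → p = m ∧ q ≠ m := by
    have irr : ∀ p, ¬ σ.lt p p := fun p => @lt_irrefl _ σ.toPreorder p
    have binary : ∀ p : Fin 2, p = 0 ∨ p = 1 := fun p => by omega
    by_cases h01 : σ.lt 0 1
    · have h10 : ¬ σ.lt 1 0 := @lt_asymm _ σ.toPreorder _ _ h01
      refine ⟨0, fun p q hpq => ?_⟩
      rcases binary p with rfl | rfl <;> rcases binary q with rfl | rfl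
      exacts [absurd hpq (irr 0), ⟨rfl, one_ne_zero⟩, absurd hpq h10, absurd hpq (irr 1)]
    · refine ⟨1, fun p q hpq => ?_⟩
      rcases binary p with rfl | rfl <;> rcases binary q with rfl | rfl
      exacts [absurd hpq (irr 0), absurd hpq h01, ⟨rfl, zero_ne_one⟩, absurd hpq (irr 1)]
  refine ⟨m, b, hy, hb, fun z hz hzb => ?_⟩
  rcases hmin z hz hzb with h | ⟨n, h1, h2⟩
  · exact Or.inl h
  · exact Or.inr ⟨n, h1, hm _ _ h2⟩

theorem get_image_eq_of_get_zero {φ : Fin 2 → List (Fin 2)} (hφ : Nonerasing φ)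
    {w w' : Stream' (Fin 2)} (h : w.get 0 = w'.get 0) {i : ℕ} (hi : i < (φ (w.get 0)).length) :
    (image φ w).get i = (image φ w').get i := by
  have h1 : StartsWith (φ (w.get 0)) (image φ w) := by
    rw [← Stream'.eta w, image_cons hφ]
    exact startsWith_append _ _
  have h2 : StartsWith (φ (w.get 0)) (image φ w') := by
    rw [h, ← Stream'.eta w', image_cons hφ]
    exact startsWith_append _ _
  rw [← h1.getElem hi, ← h2.getElem hi]

/-- An extremal word is obtained by desubstitution from another one. -/
theorem IsBinLeast.exists_desubstitution {φ : Fin 2 → List (Fin 2)} (hφ : Nonerasing φ)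
    (hcomm : φ 0 ++ φ 1 ≠ φ 1 ++ φ 0) {x y : Stream' (Fin 2)} (hx : image φ x = x) {m b : Fin 2}
    (hy : IsBinLeast m b x y) :
    ∃ m' c y' r, IsBinLeast m' c x y' ∧ y.tail = r ++ₛ image φ y'.tail := by
  obtain ⟨w, hw, j, hj, rfl⟩ := exists_drop_image_eq hφ hx hy.mem
  obtain ⟨m', hm'⟩ := exists_image_binLT hφ hcomm m
  refine ⟨m', w.get 0, w, (φ (w.get 0)).drop (j + 1), ⟨hw, rfl, fun z hz hz0 => ?_⟩, ?_⟩
  · rcases binLT_trichotomy m' w z with h | h | h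
    · exact Or.inl h
    · exact Or.inr h
    · exfalso
      -- A smaller `z` with the same first letter would have the same first block, so cutting `φ(z)`
      -- at `j` would give a word starting with `b` and smaller than the extremal one.
      have hlt := (hm' _ _ h).drop (j := j) fun i hi =>
        (get_image_eq_of_get_zero hφ hz0.symm (by omega)).symm
      have hz1 : ((image φ z).drop j).get 0 = b := by
        rw [← hy.get_zero, Stream'.get_drop, Stream'.get_drop]
        exact (get_image_eq_of_get_zero hφ hz0.symm (by omega)).symm
      rcases hy.eq_or_lt _ (drop_mem_shiftOrbitClosure
        (image_mem_shiftOrbitClosure hφ hx hz) j) hz1 with e | e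
      · rw [e] at hlt
        exact hlt.irrefl
      · exact e.asymm hlt
  · rw [Stream'.tail_drop']
    have e : image φ w = (φ (w.get 0)).take (j + 1) ++ₛ
        ((φ (w.get 0)).drop (j + 1) ++ₛ image φ w.tail) := by
      rw [← append_append_stream, List.take_append_drop, ← image_cons hφ]
      exact congrArg (image φ) (Stream'.eta w).symm
    have hl : j + 1 = ((φ (w.get 0)).take (j + 1)).length := by
      rw [List.length_take]
      omega
    have := drop_append_stream ((φ (w.get 0)).take (j + 1))
      ((φ (w.get 0)).drop (j + 1) ++ₛ image φ w.tail)
    rwa [← e, ← hl] at this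

/-- `v` is of the form `r g(v')` for a nonerasing morphism `g` that expands the letter `a`. -/
def ExpandsTo (a : Fin 2) (v v' : Stream' (Fin 2)) : Prop :=
  ∃ r g, Nonerasing g ∧ 2 ≤ (g a).length ∧ v = r ++ₛ image g v'

/-- As `a` occurs in `φ a`, the word `g(φ(a))` contains `g(a)`, so composition remains expanding at
`a`. -/
theorem ExpandsTo.step {a : Fin 2} {v v' v'' : Stream' (Fin 2)} (h : ExpandsTo a v v')
    {φ : Fin 2 → List (Fin 2)} (hφ : Nonerasing φ) (ha : a ∈ φ a) {r : List (Fin 2)}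
    (e : v' = r ++ₛ image φ v'') : ExpandsTo a v v'' := by
  obtain ⟨s, g, hg, hga, rfl⟩ := h
  refine ⟨s ++ r.flatMap g, fun b => (φ b).flatMap g, hφ.comp hg, ?_, ?_⟩
  · obtain ⟨l, l', hl⟩ := List.append_of_mem ha
    simp only [hl, List.flatMap_append, List.flatMap_cons, List.length_append]
    omega
  · rw [e, image_append hg, image_image hφ hg, append_append_stream]

theorem IsBinLeast.isMorphic {φ : Fin 2 → List (Fin 2)} {a : Fin 2} {x y : Stream' (Fin 2)}
    (hx : IsLimit φ a x) (hφ : Nonerasing φ) (hcomm : φ 0 ++ φ 1 ≠ φ 1 ++ φ 0) {m b : Fin 2}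
    (hy : IsBinLeast m b x y) : IsMorphic y := by
  have hfix := hx.image_eq hφ
  obtain ⟨u, hu, hun⟩ := hx.exists_tail
  have ha : a ∈ φ a := by simp [hu]
  have ha2 : 2 ≤ (φ a).length := by
    have : 0 < u.length := List.length_pos_iff.2 (hun 0)
    rw [hu, List.length_cons]
    omega
  let S := {s : (Fin 2 × Fin 2) × Stream' (Fin 2) // IsBinLeast s.1.1 s.1.2 x s.2}
  have hstep : ∀ s : S, ∃ s' : S, ∃ r, s.1.2.tail = r ++ₛ image φ s'.1.2.tail := by
    rintro ⟨s, hs⟩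
    obtain ⟨m', c, y', r, h, e⟩ := hs.exists_desubstitution hφ hcomm hfix
    exact ⟨⟨((m', c), y'), h⟩, r, e⟩
  choose next r hr using hstep
  let s : ℕ → S := fun n => next^[n] ⟨((m, b), y), hy⟩
  have hs : ∀ n, (s n).1.2.tail = r (s n) ++ₛ image φ (s (n + 1)).1.2.tail := by
    intro n
    have : s (n + 1) = next (s n) := Function.iterate_succ_apply' _ _ _
    rw [this]
    exact hr _
  have hexp : ∀ n k, ExpandsTo a (s n).1.2.tail (s (n + (k + 1))).1.2.tail := by
    intro n k
    induction k with
    | zero => exact ⟨_, φ, hφ, ha2, hs n⟩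
    | succ k ih => exact ih.step hφ ha (hs _)
  -- Pigeonhole on the four pairs (smaller letter, first letter); uniqueness turns equal pairs into
  -- equal words.
  obtain ⟨i, k, hik⟩ : ∃ i k, (s i).1.2 = (s (i + (k + 1))).1.2 := by
    obtain ⟨i, j, hij, h⟩ := Finite.exists_ne_map_eq_of_infinite fun n => (s n).1.1
    have main : ∀ i j, i < j → (s i).1.1 = (s j).1.1 →
        ∃ i k, (s i).1.2 = (s (i + (k + 1))).1.2 := by
      intro i j hij h
      obtain ⟨k, rfl⟩ := Nat.exists_eq_add_of_lt hij
      refine ⟨i, k, (s i).2.unique ?_⟩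
      rw [h]
      exact (s (i + (k + 1))).2
    rcases lt_or_gt_of_ne hij with hlt | hlt
    · exact main i j hlt h
    · exact main j i hlt h.symm
  have hcycle : IsMorphic (s i).1.2.tail := by
    obtain ⟨q, g, hg, hga, e⟩ := hexp i k
    rw [← hik] at e
    exact isMorphic_of_eq_append_image hg (a := a) (by omega) e
  have hdown : ∀ n, IsMorphic (s n).1.2.tail → IsMorphic (s 0).1.2.tail := by
    intro n
    induction n with
    | zero => exact id
    | succ n ih =>
      intro h
      apply ih
      rw [hs n]
      exact h.append_image hφ _
  have := (hdown i hcycle).append [y.head]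
  change IsMorphic ([y.head] ++ₛ y.tail) at this
  rwa [Stream'.append_stream_head_tail] at this

end Extremal

end MorphicWords

theorem mainTheorem3 (x : ℕ → Fin 2) (hx : MorphicWords.IsPureMorphic x)
    (y : ℕ → Fin 2) (hy : MorphicWords.IsExtremal x y) :
    MorphicWords.IsMorphic y := by
  obtain ⟨φ, a, hlim⟩ := MorphicWords.isPureMorphic_iff.1 hx
  obtain ⟨m, b, hmin⟩ := hy.exists_isBinLeast
  by_cases hcomm : φ 0 ++ φ 1 = φ 1 ++ φ 0
  · have hall : ∀ c d, φ c ++ φ d = φ d ++ φ c := by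
      intro c d
      fin_cases c <;> fin_cases d <;> simp [hcomm]
    have hpos : 0 < (φ a).length := by
      obtain ⟨u, hu, -⟩ := hlim.exists_tail
      simp [hu]
    exact MorphicWords.isMorphic_of_periodic hpos
      (MorphicWords.drop_eq_of_mem_shiftOrbitClosure (hlim.drop_eq (hall a)) hmin.mem)
  -- An empty block would commute with the other one.
  · have hφ : MorphicWords.Nonerasing φ := by
      intro c hc
      apply hcomm
      fin_cases c <;> simp_all
    exact hmin.isMorphic hlim hφ hcomm
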